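/- All rings below are associative with identity. For a ring $S$, let $S[t]$ be the polynomial ring in a variable $t$ commuting with the elements of $S$. The ring $S$ is called \emph{right linearly McCoy} if for all nonzero polynomials $f,g\in S[t]$ of degree at most $1$ with $fg=0$ there is a nonzero $s\in S$ with $fs=0$, and \emph{left linearly McCoy} if for all such $f,g$ there is a nonzero $s\in S$ with $sg=0$. An element $s\in S$ is \emph{right} (respectively \emph{left}) \emph{strongly $\pi$-regular} if $s^n=s^{n+1}t$ (respectively $s^n=ts^{n+1}$) for some $t\in S$ and some integer $n\ge 1$; it is \emph{strongly $\pi$-regular} if it is both. The ring $S$ is called \emph{right Dischinger} if every right strongly $\pi$-regular element of $S$ is strongly $\pi$-regular. \textbf{Theorem.} Let $R=\mathbb{F}_2\langle a,x : a=a^2x\rangle$ be the quotient of the free unital associative $\mathbb{F}_2$-algebra on two noncommuting generators $a,x$ by the two-sided ideal generated by $a-a^2x$. Then $R$ is both left and right linearly McCoy, but $R$ is not right Dischinger. Hence a left and right linearly McCoy ring need not be right Dischinger. -/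

import Mathlib

namespace LinMcCoy

open Polynomial

/-- `s` is right strongly π-regular: `s ^ n = s ^ (n + 1) * t` for some `t` and some `n ≥ 1`. -/
def IsRightStronglyPiRegular {S : Type*} [Ring S] (s : S) : Prop :=
  ∃ n : ℕ, 1 ≤ n ∧ ∃ t : S, s ^ n = s ^ (n + 1) * t

/-- `s` is left strongly π-regular: `s ^ n = t * s ^ (n + 1)` for some `t` and some `n ≥ 1`. -/
def IsLeftStronglyPiRegular {S : Type*} [Ring S] (s : S) : Prop :=
  ∃ n : ℕ, 1 ≤ n ∧ ∃ t : S, s ^ n = t * s ^ (n + 1)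

/-- `s` is strongly π-regular: both right and left strongly π-regular. -/
def IsStronglyPiRegular {S : Type*} [Ring S] (s : S) : Prop :=
  IsRightStronglyPiRegular s ∧ IsLeftStronglyPiRegular s

/-- A ring is right Dischinger if each of its right strongly π-regular elements is
strongly π-regular. -/
def IsRightDischinger (S : Type*) [Ring S] : Prop :=
  ∀ s : S, IsRightStronglyPiRegular s → IsStronglyPiRegular s

/-- A ring `S` is right linearly McCoy if, whenever `f * g = 0` for nonzero polynomials
`f, g ∈ S[t]` of degree at most one (the variable commutes with `S`), some nonzero constant
`s ∈ S` satisfies `f * s = 0`. -/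
def IsRightLinearlyMcCoy (S : Type*) [Ring S] : Prop :=
  ∀ f g : S[X], f ≠ 0 → g ≠ 0 → f.natDegree ≤ 1 → g.natDegree ≤ 1 → f * g = 0 →
    ∃ s : S, s ≠ 0 ∧ f * C s = 0

/-- A ring `S` is left linearly McCoy if, whenever `f * g = 0` for nonzero polynomials
`f, g ∈ S[t]` of degree at most one, some nonzero constant `s ∈ S` satisfies `s * g = 0`. -/
def IsLeftLinearlyMcCoy (S : Type*) [Ring S] : Prop :=
  ∀ f g : S[X], f ≠ 0 → g ≠ 0 → f.natDegree ≤ 1 → g.natDegree ≤ 1 → f * g = 0 →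
    ∃ s : S, s ≠ 0 ∧ C s * g = 0

/-- The two letters `a` and `x`. -/
inductive Letter : Type
  | a
  | x

/-- The single defining relation `a = a ^ 2 * x` in the free algebra `𝔽₂⟨a, x⟩`. -/
inductive Rel : FreeAlgebra (ZMod 2) Letter → FreeAlgebra (ZMod 2) Letter → Prop
  | rel : Rel (FreeAlgebra.ι (ZMod 2) Letter.a)
      (FreeAlgebra.ι (ZMod 2) Letter.a ^ 2 * FreeAlgebra.ι (ZMod 2) Letter.x)

/-- The ring `𝔽₂⟨a, x : a = a ^ 2 * x⟩`: the quotient of the free unital associative algebra on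
`a, x` by the two-sided ideal generated by `a - a ^ 2 * x`. -/
abbrev R : Type := RingQuot Rel

end LinMcCoy

/-! Let `R` act on the free algebra `V`: `x` is left multiplication by `X₁`, and `a` strips a
leading `X₁`, then multiplies by `1 - Z₁`. So `1 - a x` acts as `Z₁` and `a` kills `1`. Moving
powers of `a` to the right writes a nonzero element as `s * a ^ m` with `s` not killing `1`
(`exists_eq_mul_pow`).

The crux is that such an `s` acts injectively (`IsAdmissible.map_ne_zero`). Filter `V` by the
kernels of `S ^ n`. Modulo the image of the `n`-th kernel, the image of `X₁ ^ n` has a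
representative `G` whose leading form cannot be cancelled, even after right multiplication by a
nonzero `b`.

Hence the action is faithful, and `f * g = 0` with `f = s * a ^ m` forces `a ^ m * g = 0`. If `g ≠
0` then `m ≥ 1`, so `f` kills `1 - a x`: this one element serves on the right, and a high power of
`a` on the left. Finally `a = a ^ 2 * x`, whereas `X₁ ^ n` is killed by `a ^ (n + 1)` but not by `a
^ n`. -/

namespace LinMcCoy
open Polynomial

/-! ### The free algebra on two letters -/

/-- The free algebra `𝔽₂⟨X, Z⟩`. -/
abbrev V : Type := FreeAlgebra (ZMod 2) Bool

/-- The first free generator. -/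
def X₁ : V := FreeAlgebra.ι (ZMod 2) true

/-- The second free generator. -/
def Z₁ : V := FreeAlgebra.ι (ZMod 2) false

/-- The augmentation, sending both generators to zero. -/
def aug : V →ₐ[ZMod 2] ZMod 2 := FreeAlgebra.lift (ZMod 2) fun _ => 0

theorem eq_zero_or_eq_one : ∀ r : ZMod 2, r = 0 ∨ r = 1 := by decide

theorem V_induction {P : V → Prop} (h1 : P 1) (hX : P X₁) (hZ : P Z₁)
    (hmul : ∀ u v, P u → P v → P (u * v)) (hadd : ∀ u v, P u → P v → P (u + v)) (v : V) : P v := by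
  have h0 : P 0 := by
    have := hadd 1 1 h1 h1
    rwa [CharTwo.add_self_eq_zero] at this
  induction v using FreeAlgebra.induction with
  | grade0 r =>
    rcases eq_zero_or_eq_one r with rfl | rfl
    · simpa using h0
    · simpa using h1
  | grade1 b => cases b <;> assumption
  | mul u v hu hv => exact hmul u v hu hv
  | add u v hu hv => exact hadd u v hu hv

/-! ### Stripping letters on the left and on the right -/

/-- The algebra homomorphism `v ↦ !![aug v, S v; 0, v]` encoding the left transduction `S`. -/
def foxLeft : V →ₐ[ZMod 2] Matrix (Fin 2) (Fin 2) V :=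
  FreeAlgebra.lift (ZMod 2) fun b =>
    !![0, if b then 1 else 0; 0, FreeAlgebra.ι (ZMod 2) b]

/-- The algebra homomorphism `v ↦ !![v, T v; 0, aug v]` encoding the right transduction for the
letter `c`. -/
def foxRight (c : Bool) : V →ₐ[ZMod 2] Matrix (Fin 2) (Fin 2) V :=
  FreeAlgebra.lift (ZMod 2) fun b =>
    !![FreeAlgebra.ι (ZMod 2) b, if b = c then 1 else 0; 0, 0]

/-- Left transduction: strips a leading `X₁`. -/
def S : V →ₗ[ZMod 2] V := (Matrix.entryLinearMap (ZMod 2) V 0 1) ∘ₗ foxLeft.toLinearMap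

/-- Right transduction: strips a trailing letter `c`. -/
def T (c : Bool) : V →ₗ[ZMod 2] V :=
  (Matrix.entryLinearMap (ZMod 2) V 0 1) ∘ₗ (foxRight c).toLinearMap

theorem S_apply (v : V) : S v = foxLeft v 0 1 := rfl

theorem T_apply (c : Bool) (v : V) : T c v = foxRight c v 0 1 := rfl

@[simp] theorem aug_X₁ : aug X₁ = 0 := by simp [aug, X₁]
@[simp] theorem aug_Z₁ : aug Z₁ = 0 := by simp [aug, Z₁]
@[simp] theorem S_one : S 1 = 0 := by simp [S_apply]
@[simp] theorem S_X₁ : S X₁ = 1 := by simp [S_apply, foxLeft, X₁]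
@[simp] theorem S_Z₁ : S Z₁ = 0 := by simp [S_apply, foxLeft, Z₁]
@[simp] theorem T_one (c : Bool) : T c 1 = 0 := by simp [T_apply]
@[simp] theorem T_X₁ (c : Bool) : T c X₁ = if c then 1 else 0 := by
  cases c <;> simp [T_apply, foxRight, X₁]
@[simp] theorem T_Z₁ (c : Bool) : T c Z₁ = if c then 0 else 1 := by
  cases c <;> simp [T_apply, foxRight, Z₁]

theorem foxLeft_entries (v : V) :
    foxLeft v 0 0 = algebraMap _ V (aug v) ∧ foxLeft v 1 0 = 0 ∧ foxLeft v 1 1 = v := by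
  induction v using V_induction with
  | h1 => simp
  | hX => simp [foxLeft, X₁, aug]
  | hZ => simp [foxLeft, Z₁, aug]
  | hmul u v hu hv => simp [Matrix.mul_apply, hu, hv]
  | hadd u v hu hv => simp [hu, hv]

theorem foxRight_entries (c : Bool) (v : V) :
    foxRight c v 0 0 = v ∧ foxRight c v 1 0 = 0 ∧ foxRight c v 1 1 = algebraMap _ V (aug v) := by
  induction v using V_induction with
  | h1 => simp
  | hX => simp [foxRight, X₁, aug]
  | hZ => simp [foxRight, Z₁, aug]
  | hmul u v hu hv => simp [Matrix.mul_apply, hu, hv]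
  | hadd u v hu hv => simp [hu, hv]

theorem S_mul (u v : V) : S (u * v) = aug u • S v + S u * v := by
  simp [S_apply, Matrix.mul_apply, foxLeft_entries, Algebra.smul_def]

theorem T_mul (c : Bool) (u v : V) : T c (u * v) = u * T c v + aug v • T c u := by
  simp [T_apply, Matrix.mul_apply, foxRight_entries, Algebra.smul_def, Algebra.commutes]

@[simp] theorem S_X₁_mul (v : V) : S (X₁ * v) = v := by simp [S_mul]
@[simp] theorem S_Z₁_mul (v : V) : S (Z₁ * v) = 0 := by simp [S_mul]

theorem S_mul_of_S_eq_zero (v : V) {b : V} (hb : S b = 0) : S (v * b) = S v * b := by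
  simp [S_mul, hb]

@[simp] theorem S_algebraMap (c : ZMod 2) : S (algebraMap _ V c) = 0 := by
  simp [Algebra.algebraMap_eq_smul_one]

/-- Makes the kernel of `S` stable under right stripping. -/
theorem S_T (c : Bool) (v : V) : S (T c v) = T c (S v) := by
  induction v using V_induction with
  | h1 => simp
  | hX => cases c <;> simp
  | hZ => cases c <;> simp
  | hmul u v hu hv => simp [S_mul, T_mul, hu, hv]; abel
  | hadd u v hu hv => simp [hu, hv]

theorem aug_add_strip (v : V) :
    v = aug v • 1 + (T true v * X₁ + T false v * Z₁) := by
  induction v using V_induction with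
  | h1 => simp
  | hX => simp
  | hZ => simp
  | hmul u v hu hv =>
    calc u * v = u * (aug v • 1 + (T true v * X₁ + T false v * Z₁)) := congrArg (u * ·) hv
      _ = aug v • u + (u * T true v * X₁ + u * T false v * Z₁) := by
        simp [mul_add, mul_assoc]
      _ = aug v • (aug u • 1 + (T true u * X₁ + T false u * Z₁))
            + (u * T true v * X₁ + u * T false v * Z₁) :=
        congrArg (fun t => aug v • t + (u * T true v * X₁ + u * T false v * Z₁)) hu
      _ = _ := by
        simp only [T_mul, map_mul, smul_add, add_mul, smul_mul_assoc, smul_smul, mul_comm (aug v)]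
        abel
  | hadd u v hu hv =>
    calc u + v = _ := congrArg₂ (· + ·) hu hv
      _ = _ := by
        simp only [map_add, add_mul, add_smul]
        abel

/-! ### The degree filtration -/

/-- The span of `1` and the two generators. -/
def W : Submodule (ZMod 2) V := Submodule.span (ZMod 2) {1, X₁, Z₁}

/-- The elements of degree less than `n`. -/
def Fl : ℕ → Submodule (ZMod 2) V
  | 0 => ⊥
  | n + 1 => W ^ n

theorem one_mem_W : (1 : V) ∈ W := Submodule.subset_span (by simp)
theorem X₁_mem_W : X₁ ∈ W := Submodule.subset_span (by simp)
theorem Z₁_mem_W : Z₁ ∈ W := Submodule.subset_span (by simp)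

theorem Fl_zero {v : V} : v ∈ Fl 0 ↔ v = 0 := Submodule.mem_bot _

theorem Fl_mul {m n : ℕ} {u v : V} (hu : u ∈ Fl (m + 1)) (hv : v ∈ Fl n) :
    u * v ∈ Fl (m + n) := by
  cases n with
  | zero => rw [Fl_zero] at hv; subst hv; simp
  | succ n =>
    change u * v ∈ W ^ (m + n)
    rw [pow_add]
    exact Submodule.mul_mem_mul hu hv

theorem one_mem_Fl : (1 : V) ∈ Fl 1 := by
  change (1 : V) ∈ W ^ 0
  simp

theorem W_eq : Fl 2 = W := pow_one W

theorem Fl_succ {n : ℕ} {v : V} (hv : v ∈ Fl n) : v ∈ Fl (n + 1) := by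
  have h : (1 : V) ∈ Fl 2 := W_eq ▸ one_mem_W
  have := Fl_mul h hv
  rwa [one_mul, add_comm] at this

theorem Fl_mono {m n : ℕ} (h : m ≤ n) {v : V} (hv : v ∈ Fl m) : v ∈ Fl n := by
  induction n, h using Nat.le_induction with
  | base => exact hv
  | succ n _ ih => exact Fl_succ ih

theorem mul_X₁_mem_Fl {n : ℕ} {v : V} (hv : v ∈ Fl n) : v * X₁ ∈ Fl (n + 1) := by
  cases n with
  | zero => rw [Fl_zero] at hv; subst hv; simp
  | succ n => exact Fl_mul (n := 2) hv (W_eq ▸ X₁_mem_W)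

theorem mul_Z₁_mem_Fl {n : ℕ} {v : V} (hv : v ∈ Fl n) : v * Z₁ ∈ Fl (n + 1) := by
  cases n with
  | zero => rw [Fl_zero] at hv; subst hv; simp
  | succ n => exact Fl_mul (n := 2) hv (W_eq ▸ Z₁_mem_W)

theorem exists_mem_Fl (v : V) : ∃ n, v ∈ Fl (n + 1) := by
  induction v using V_induction with
  | h1 => exact ⟨0, one_mem_Fl⟩
  | hX => exact ⟨1, W_eq ▸ X₁_mem_W⟩
  | hZ => exact ⟨1, W_eq ▸ Z₁_mem_W⟩
  | hmul u v hu hv =>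
    obtain ⟨m, hm⟩ := hu
    obtain ⟨n, hn⟩ := hv
    exact ⟨m + n, Fl_mul (n := n + 1) hm hn⟩
  | hadd u v hu hv =>
    obtain ⟨m, hm⟩ := hu
    obtain ⟨n, hn⟩ := hv
    exact ⟨m + n, add_mem (Fl_mono (by omega) hm) (Fl_mono (by omega) hn)⟩

theorem exists_degree {v : V} (hv : v ≠ 0) : ∃ n, v ∈ Fl (n + 1) ∧ v ∉ Fl n := by
  classical
  obtain ⟨n, hn⟩ := exists_mem_Fl v
  have h : ∃ n, v ∈ Fl n := ⟨_, hn⟩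
  have h0 : Nat.find h ≠ 0 := fun h0 => hv (Fl_zero.1 (h0 ▸ Nat.find_spec h))
  obtain ⟨k, hk⟩ := Nat.exists_eq_succ_of_ne_zero h0
  have hs := Nat.find_spec h
  rw [hk] at hs
  exact ⟨k, hs, Nat.find_min h (by omega)⟩

theorem W_cases {P : V → Prop} (h1 : P 1) (hX : P X₁) (hZ : P Z₁)
    (hadd : ∀ u v, P u → P v → P (u + v)) {w : V} (hw : w ∈ W) : P w := by
  have h0 : P 0 := by
    have := hadd 1 1 h1 h1
    rwa [CharTwo.add_self_eq_zero] at this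
  induction hw using Submodule.span_induction with
  | mem v hv => rcases hv with rfl | rfl | rfl <;> assumption
  | zero => exact h0
  | add u v _ _ hu hv => exact hadd u v hu hv
  | smul c v _ hv =>
    rcases eq_zero_or_eq_one c with rfl | rfl
    · simpa using h0
    · simpa using hv

theorem T_mem_W {c : Bool} {w : V} (hw : w ∈ W) : T c w ∈ Fl 1 := by
  refine W_cases (P := fun w => T c w ∈ Fl 1) ?_ ?_ ?_ (fun u v hu hv => ?_) hw
  · simp
  · cases c <;> simp [one_mem_Fl]
  · cases c <;> simp [one_mem_Fl]
  · simpa using add_mem hu hv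

theorem T_mem_Fl (c : Bool) {n : ℕ} {v : V} (hv : v ∈ Fl (n + 1)) : T c v ∈ Fl n := by
  induction n generalizing v with
  | zero =>
    have h : v ∈ (1 : Submodule (ZMod 2) V) := by simpa [Fl] using hv
    obtain ⟨r, rfl⟩ := Submodule.mem_one.1 h
    simp [Algebra.algebraMap_eq_smul_one]
  | succ n ih =>
    have h : v ∈ W ^ n * W := by simpa [Fl, pow_succ] using hv
    induction h using Submodule.mul_induction_on' with
    | mem_mul_mem u hu w hw =>
      rw [T_mul]
      exact add_mem (Fl_mul hu (T_mem_W hw)) (Submodule.smul_mem _ _ (Fl_succ (ih hu)))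
    | add u hu w hw h1 h2 =>
      rw [map_add]
      refine add_mem (h1 ?_) (h2 ?_)
      · simpa [Fl, pow_succ] using hu
      · simpa [Fl, pow_succ] using hw

theorem S_mem_W {w : V} (hw : w ∈ W) : S w ∈ Fl 1 := by
  refine W_cases (P := fun w => S w ∈ Fl 1) ?_ ?_ ?_ (fun u v hu hv => ?_) hw
  · simp
  · simp [one_mem_Fl]
  · simp
  · simpa using add_mem hu hv

theorem S_mem_Fl {n : ℕ} {v : V} (hv : v ∈ Fl (n + 1)) : S v ∈ Fl n := by
  induction n generalizing v with
  | zero =>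
    have h : v ∈ (1 : Submodule (ZMod 2) V) := by simpa [Fl] using hv
    obtain ⟨r, rfl⟩ := Submodule.mem_one.1 h
    simp
  | succ n ih =>
    have h : v ∈ W ^ n * W := by simpa [Fl, pow_succ] using hv
    induction h using Submodule.mul_induction_on' with
    | mem_mul_mem u hu w hw =>
      rw [S_mul]
      refine add_mem (Submodule.smul_mem _ _ (Fl_mono (by omega) (S_mem_W hw))) ?_
      cases n with
      | zero => simp [Fl_zero.1 (ih hu)]
      | succ n => exact Fl_mul (n := 2) (ih hu) (W_eq ▸ hw)
    | add u hu w hw h1 h2 =>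
      rw [map_add]
      refine add_mem (h1 ?_) (h2 ?_)
      · simpa [Fl, pow_succ] using hu
      · simpa [Fl, pow_succ] using hw

/-- The first and last letters of a word of length one coincide. Thus an element of `ker S` of
degree at most one has no `X₁` term. -/
theorem S_eq_T_of_mem_Fl_two {b : V} (hb : b ∈ Fl 2) : S b = T true b := by
  rw [W_eq] at hb
  refine W_cases (P := fun w => S w = T true w) ?_ ?_ ?_ (fun u v hu hv => ?_) hb
  · simp
  · simp
  · simp
  · simp [hu, hv]

theorem mem_Fl_of_strip {n : ℕ} {p q : V} (h : p * X₁ + q * Z₁ ∈ Fl (n + 1)) :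
    p ∈ Fl n ∧ q ∈ Fl n := by
  have h1 := T_mem_Fl true h
  have h2 := T_mem_Fl false h
  simp [T_mul] at h1 h2
  exact ⟨h1, h2⟩

theorem S_pow_eq_zero {n : ℕ} {v : V} (hv : v ∈ Fl n) : (S ^ n) v = 0 := by
  induction n generalizing v with
  | zero => simpa using Fl_zero.1 hv
  | succ n ih => rw [pow_succ, Module.End.mul_apply, ih (S_mem_Fl hv)]

theorem S_pow_X₁_pow_mul (n : ℕ) (v : V) : (S ^ n) (X₁ ^ n * v) = v := by
  induction n with
  | zero => simp
  | succ n ih => rw [pow_succ, Module.End.mul_apply, pow_succ', mul_assoc, S_X₁_mul, ih]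

theorem S_pow_mul_of_S_eq_zero (n : ℕ) (v : V) {b : V} (hb : S b = 0) :
    (S ^ n) (v * b) = (S ^ n) v * b := by
  induction n with
  | zero => simp
  | succ n ih =>
    rw [pow_succ', Module.End.mul_apply, Module.End.mul_apply, ih, S_mul_of_S_eq_zero _ hb]

theorem S_pow_succ_mul_X₁ (n : ℕ) (v : V) (hv : (S ^ n) v = 0) : (S ^ (n + 1)) (v * X₁) = 0 := by
  induction n generalizing v with
  | zero =>
    have : v = 0 := by simpa using hv
    simp [this]
  | succ n ih =>
    rw [pow_succ, Module.End.mul_apply] at hv ⊢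
    rw [S_mul, map_add, ih _ hv]
    simp [pow_succ]

/-! ### Injectivity of the operators `f` with `f 1 ≠ 0` -/

/-- The operators that commute with right multiplication by `ker S` and commute with right
multiplication by `X₁` modulo the left ideal generated by `1 - Z₁`. -/
structure IsAdmissible (f : V →ₗ[ZMod 2] V) : Prop where
  map_mul : ∀ v b, S b = 0 → f (v * b) = f v * b
  map_mul_X₁ : ∀ v, ∃ w, f (v * X₁) = f v * X₁ + w * (1 - Z₁)

/-- The image under `f` of the kernel of `S ^ n`. -/
def Q (f : V →ₗ[ZMod 2] V) (n : ℕ) : Submodule (ZMod 2) V := (LinearMap.ker (S ^ n)).map f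

theorem mem_Q {f : V →ₗ[ZMod 2] V} {n : ℕ} {q : V} :
    q ∈ Q f n ↔ ∃ v, (S ^ n) v = 0 ∧ f v = q := by
  simp [Q]

theorem Q_succ {f : V →ₗ[ZMod 2] V} {n : ℕ} {q : V} (hq : q ∈ Q f n) : q ∈ Q f (n + 1) := by
  obtain ⟨v, hv, rfl⟩ := mem_Q.1 hq
  exact mem_Q.2 ⟨v, by rw [pow_succ', Module.End.mul_apply, hv, map_zero], rfl⟩

theorem S_one_sub_Z₁ : S (1 - Z₁) = 0 := by simp

theorem IsAdmissible.Q_mul {f : V →ₗ[ZMod 2] V} (hf : IsAdmissible f) {n : ℕ} {q b : V}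
    (hq : q ∈ Q f n) (hb : S b = 0) : q * b ∈ Q f n := by
  obtain ⟨v, hv, rfl⟩ := mem_Q.1 hq
  exact mem_Q.2 ⟨v * b, by rw [S_pow_mul_of_S_eq_zero _ _ hb, hv, zero_mul], hf.map_mul v b hb⟩

theorem IsAdmissible.Q_mul_X₁ {f : V →ₗ[ZMod 2] V} (hf : IsAdmissible f) {n : ℕ} {q : V}
    (hq : q ∈ Q f n) : ∃ q' ∈ Q f (n + 1), ∃ w, q * X₁ = q' + w * (1 - Z₁) := by
  obtain ⟨v, hv, rfl⟩ := mem_Q.1 hq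
  obtain ⟨w, hw⟩ := hf.map_mul_X₁ v
  exact ⟨f (v * X₁), mem_Q.2 ⟨_, S_pow_succ_mul_X₁ n v hv, rfl⟩, -w, by rw [hw]; noncomm_ring⟩

/-- Split `v` as `X₁ ^ n * (S ^ n) v` plus a remainder in the kernel of `S ^ n`. -/
theorem IsAdmissible.map_eq {f : V →ₗ[ZMod 2] V} (hf : IsAdmissible f) {n : ℕ} {v : V}
    (hv : (S ^ (n + 1)) v = 0) :
    S ((S ^ n) v) = 0 ∧ ∃ q ∈ Q f n, f v = f (X₁ ^ n) * (S ^ n) v + q := by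
  have hb : S ((S ^ n) v) = 0 := by rwa [pow_succ', Module.End.mul_apply] at hv
  refine ⟨hb, f (v - X₁ ^ n * (S ^ n) v), mem_Q.2 ⟨_, ?_, rfl⟩, ?_⟩
  · rw [map_sub, S_pow_X₁_pow_mul, sub_self]
  · rw [map_sub, hf.map_mul _ _ hb]
    abel

theorem mul_mem_Fl_of_mem_Fl {d m : ℕ} {G b : V} (hG : G ∈ Fl (d + 1)) (hb : b ∈ Fl m) :
    G * b ∈ Fl (d + m) := Fl_mul hG hb

/-! ### Representatives with uncancellable leading form -/

/-- Leading terms of elements of `P` of degree at least `d` may be stripped from the right. -/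
def HasStrip (P : Submodule (ZMod 2) V) (d : ℕ) : Prop :=
  ∀ M, d ≤ M → ∀ q ∈ P, q ∈ Fl (M + 1) →
    ∃ p ∈ P, ∃ r ∈ P, p ∈ Fl M ∧ r ∈ Fl M ∧ q - (p * X₁ + r * Z₁) ∈ Fl M

/-- `G` has degree `d`, its leading form is not one of an element of `P`, and elements of `P` of
degree at least `d` can be stripped. -/
structure IsReduced (P : Submodule (ZMod 2) V) (G : V) (d : ℕ) : Prop where
  mem : G ∈ Fl (d + 1)
  add_notMem : ∀ q ∈ P, G + q ∉ Fl d
  strip : HasStrip P d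

/-- Strip a trailing letter from `b` and `q` together. If the top degree cancelled, it would cancel
for both right strips of `b`, one of which keeps full degree; induction ends at a constant `b`,
where reducedness applies. -/
theorem IsReduced.add_mul_notMem {P : Submodule (ZMod 2) V} {G : V} {d : ℕ}
    (h : IsReduced P G d) {m : ℕ} {b : V} (hb : b ∈ Fl (m + 1)) (hb' : b ∉ Fl m) {q : V}
    (hq : q ∈ P) : G * b + q ∉ Fl (d + m) := by
  induction m generalizing b q with
  | zero =>
    have hb1 : b ∈ (1 : Submodule (ZMod 2) V) := by simpa [Fl] using hb
    obtain ⟨r, rfl⟩ := Submodule.mem_one.1 hb1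
    rcases eq_zero_or_eq_one r with rfl | rfl
    · simp at hb'
    · simpa using h.add_notMem q hq
  | succ m ih =>
    intro (hmem : G * b + q ∈ Fl (d + m + 1))
    have hGb := mul_mem_Fl_of_mem_Fl h.mem hb
    have hq1 : q ∈ Fl (d + m + 1 + 1) := by
      have := sub_mem (Fl_succ hmem) hGb
      rwa [add_sub_cancel_left] at this
    obtain ⟨p, hp, r, hr, -, -, hs⟩ := h.strip (d + m + 1) (by omega) q hq hq1
    have hc : G * (aug b • 1) ∈ Fl (d + m + 1) := by
      rw [mul_smul_comm, mul_one]
      exact Submodule.smul_mem _ _ (Fl_mono (by omega) h.mem)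
    have key : (G * T true b + p) * X₁ + (G * T false b + r) * Z₁ ∈ Fl (d + m + 1) := by
      have h1 := sub_mem (sub_mem hmem hs) hc
      have h2 : G * b = G * (aug b • 1) + (G * T true b * X₁ + G * T false b * Z₁) := by
        conv_lhs => rw [aug_add_strip b]
        rw [mul_add, mul_add, mul_assoc, mul_assoc]
      rw [h2] at h1
      convert h1 using 1
      rw [add_mul, add_mul]
      abel
    obtain ⟨k1, k2⟩ := mem_Fl_of_strip key
    have t1 : T true b ∈ Fl m := by
      by_contra hn
      exact ih (T_mem_Fl _ hb) hn hp k1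
    have t2 : T false b ∈ Fl m := by
      by_contra hn
      exact ih (T_mem_Fl _ hb) hn hr k2
    apply hb'
    rw [aug_add_strip b]
    exact add_mem (Submodule.smul_mem _ _ (Fl_mono (by omega) one_mem_Fl))
      (add_mem (mul_X₁_mem_Fl t1) (mul_Z₁_mem_Fl t2))

theorem IsReduced.mem_of_add_mul_mem {P : Submodule (ZMod 2) V} {G : V} {d : ℕ}
    (h : IsReduced P G d) {m : ℕ} {b q : V} (hq : q ∈ P) (hmem : G * b + q ∈ Fl (d + m)) :
    b ∈ Fl m := by
  by_cases hb0 : b = 0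
  · simp [hb0]
  · obtain ⟨k, hk, hk'⟩ := exists_degree hb0
    by_contra hb
    refine h.add_mul_notMem hk hk' hq (Fl_mono ?_ hmem)
    have : ¬ k + 1 ≤ m := fun hle => hb (Fl_mono hle hk)
    omega

/-- The reduced representatives of `f (X₁ ^ n)` modulo `Q f n`. -/
def HasReduced (f : V →ₗ[ZMod 2] V) (n : ℕ) : Prop :=
  ∃ G d, IsReduced (Q f n) G d ∧ f (X₁ ^ n) - G ∈ Q f n

theorem IsAdmissible.mem_Q_succ {f : V →ₗ[ZMod 2] V} (hf : IsAdmissible f) {n : ℕ} {G q : V}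
    (hG : f (X₁ ^ n) - G ∈ Q f n) (hq : q ∈ Q f (n + 1)) :
    ∃ b, S b = 0 ∧ ∃ p ∈ Q f n, q = G * b + p := by
  obtain ⟨v, hv, rfl⟩ := mem_Q.1 hq
  obtain ⟨hb, p, hp, hfv⟩ := hf.map_eq hv
  refine ⟨_, hb, _, add_mem (hf.Q_mul hG hb) hp, ?_⟩
  rw [hfv]
  noncomm_ring

theorem IsAdmissible.mul_add_mem_Q_succ {f : V →ₗ[ZMod 2] V} (hf : IsAdmissible f) {n : ℕ}
    {G : V} (hG : f (X₁ ^ n) - G ∈ Q f n) {b : V} (hb : S b = 0) {p : V} (hp : p ∈ Q f n) :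
    G * b + p ∈ Q f (n + 1) := by
  have h1 : f (X₁ ^ n) ∈ Q f (n + 1) := mem_Q.2 ⟨X₁ ^ n, by
    have := S_pow_X₁_pow_mul n 1
    rw [mul_one] at this
    rw [pow_succ', Module.End.mul_apply, this, S_one], rfl⟩
  have h2 : G ∈ Q f (n + 1) := by
    have := sub_mem h1 (Q_succ hG)
    rwa [sub_sub_cancel] at this
  exact add_mem (hf.Q_mul h2 hb) (Q_succ hp)

/-- Write `q = G * b + p` and strip `b` and `p` separately. The constant term of `b` leaves a
multiple of `G`, of degree at most `d`, which is negligible only from `d + 1` on. -/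
theorem IsAdmissible.hasStrip_succ {f : V →ₗ[ZMod 2] V} (hf : IsAdmissible f) {n d : ℕ} {G : V}
    (hr : IsReduced (Q f n) G d) (hG : f (X₁ ^ n) - G ∈ Q f n) :
    HasStrip (Q f (n + 1)) (d + 1) := by
  intro M hM q hq hqM
  obtain ⟨m, rfl⟩ := Nat.exists_eq_add_of_le hM
  obtain ⟨b, hb, p, hp, rfl⟩ := hf.mem_Q_succ hG hq
  have hbm : b ∈ Fl (m + 1 + 1) := hr.mem_of_add_mul_mem hp (by convert hqM using 2; omega)
  have hGb := mul_mem_Fl_of_mem_Fl hr.mem hbm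
  have hpM : p ∈ Fl (d + 1 + m + 1) := by
    have := sub_mem hqM (Fl_mono (by omega) hGb : G * b ∈ Fl (d + 1 + m + 1))
    rwa [add_sub_cancel_left] at this
  obtain ⟨s, hs, t, ht, hsM, htM, hst⟩ := hr.strip (d + 1 + m) (by omega) p hp hpM
  have hT : ∀ c, S (T c b) = 0 := fun c => by rw [S_T, hb, map_zero]
  have hTM : ∀ c, G * T c b ∈ Fl (d + 1 + m) := fun c =>
    Fl_mono (by omega) (mul_mem_Fl_of_mem_Fl hr.mem (T_mem_Fl c hbm))
  refine ⟨_, hf.mul_add_mem_Q_succ hG (hT true) hs, _, hf.mul_add_mem_Q_succ hG (hT false) ht,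
    add_mem (hTM _) hsM, add_mem (hTM _) htM, ?_⟩
  have hc : G * (aug b • 1) ∈ Fl (d + 1 + m) := by
    rw [mul_smul_comm, mul_one]
    exact Submodule.smul_mem _ _ (Fl_mono (by omega) hr.mem)
  have h2 : G * b = G * (aug b • 1) + (G * T true b * X₁ + G * T false b * Z₁) := by
    conv_lhs => rw [aug_add_strip b]
    rw [mul_add, mul_add, mul_assoc, mul_assoc]
  rw [h2]
  convert add_mem hc hst using 1
  rw [add_mul, add_mul]
  abel

/-- Every coset of a submodule contains zero or an element whose degree cannot be lowered. -/
theorem exists_minimal_representative (P : Submodule (ZMod 2) V) (u : V) :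
    ∃ u', u - u' ∈ P ∧ (u' = 0 ∨ ∃ k, u' ∈ Fl (k + 1) ∧ ∀ q ∈ P, u' + q ∉ Fl k) := by
  classical
  have h : ∃ m, ∃ q ∈ P, u + q ∈ Fl m := by
    obtain ⟨n, hn⟩ := exists_mem_Fl u
    exact ⟨_, 0, zero_mem _, by simpa using hn⟩
  obtain ⟨q, hq, hm⟩ := Nat.find_spec h
  refine ⟨u + q, by simpa using hq, ?_⟩
  rcases hk : Nat.find h with _ | k
  · rw [hk, Fl_zero] at hm
    exact Or.inl hm
  · rw [hk] at hm
    refine Or.inr ⟨k, hm, fun q' hq' hmem => Nat.find_min h (m := k) (by omega) ?_⟩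
    exact ⟨q + q', add_mem hq hq', by rwa [← add_assoc]⟩

theorem HasStrip.mono {P : Submodule (ZMod 2) V} {d e : ℕ} (h : HasStrip P d) (hde : d ≤ e) :
    HasStrip P e := fun M hM => h M (hde.trans hM)

/-- The next reduced element when the correction `u` has degree at most `d`. -/
theorem IsAdmissible.isReduced_succ_low {f : V →ₗ[ZMod 2] V} (hf : IsAdmissible f) {n d : ℕ}
    {G u : V} (hr : IsReduced (Q f n) G d) (hG : f (X₁ ^ n) - G ∈ Q f n) (hu : u ∈ Fl (d + 1)) :
    IsReduced (Q f (n + 1)) (G * X₁ + u * (1 - Z₁)) (d + 1) := by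
  have hmem : G * X₁ + u * (1 - Z₁) ∈ Fl (d + 1 + 1) := by
    rw [mul_sub, mul_one]
    exact add_mem (mul_X₁_mem_Fl hr.mem) (sub_mem (Fl_succ hu) (mul_Z₁_mem_Fl hu))
  refine ⟨hmem, fun q hq hcon => ?_, hf.hasStrip_succ hr hG⟩
  have hqM : q ∈ Fl (d + 1 + 1) := by
    have := sub_mem (Fl_succ hcon) hmem
    rwa [add_sub_cancel_left] at this
  obtain ⟨b, hb, p, hp, rfl⟩ := hf.mem_Q_succ hG hq
  have hbm : b ∈ Fl 2 := hr.mem_of_add_mul_mem hp hqM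
  -- So `G * b` contributes nothing ending in `X₁` at the top degree `d + 1`.
  have hTb : T true b = 0 := by rw [← S_eq_T_of_mem_Fl_two hbm, hb]
  have hGb := mul_mem_Fl_of_mem_Fl hr.mem hbm
  have hpM : p ∈ Fl (d + 1 + 1) := by
    have := sub_mem hqM hGb
    rwa [add_sub_cancel_left] at this
  obtain ⟨s, hs, t, ht, -, -, hst⟩ := hr.strip (d + 1) (by omega) p hp hpM
  have hc : G * (aug b • 1) ∈ Fl (d + 1) := by
    rw [mul_smul_comm, mul_one]
    exact Submodule.smul_mem _ _ hr.mem
  have h2 : G * b = G * (aug b • 1) + G * T false b * Z₁ := by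
    conv_lhs => rw [aug_add_strip b, hTb]
    rw [zero_mul, zero_add, mul_add, mul_assoc]
  have key : (G + s) * X₁ + (G * T false b + t - u) * Z₁ ∈ Fl (d + 1) := by
    rw [h2] at hcon
    convert sub_mem (sub_mem (sub_mem hcon hst) hc) hu using 1
    rw [add_mul, sub_mul, add_mul, mul_sub, mul_one]
    abel
  -- The coefficient of `X₁` says that `s ∈ Q f n` cancels the leading form of `G`.
  exact hr.add_notMem s hs (mem_Fl_of_strip key).1

/-- The next reduced element when the correction `u` has degree greater than `d`. -/
theorem IsAdmissible.isReduced_succ_high {f : V →ₗ[ZMod 2] V} (hf : IsAdmissible f) {n d k : ℕ}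
    {G u : V} (hr : IsReduced (Q f n) G d) (hG : f (X₁ ^ n) - G ∈ Q f n) (hk : d + 1 ≤ k)
    (hu : u ∈ Fl (k + 1)) (hu' : ∀ q ∈ Q f (n + 1), u + q ∉ Fl k) :
    IsReduced (Q f (n + 1)) (G * X₁ + u * (1 - Z₁)) (k + 1) := by
  have hGX : G * X₁ ∈ Fl (k + 1) := Fl_mono (by omega) (mul_X₁_mem_Fl hr.mem)
  have hmem : G * X₁ + u * (1 - Z₁) ∈ Fl (k + 1 + 1) := by
    rw [mul_sub, mul_one]
    exact add_mem (Fl_succ hGX) (sub_mem (Fl_succ hu) (mul_Z₁_mem_Fl hu))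
  refine ⟨hmem, fun q hq hcon => ?_, (hf.hasStrip_succ hr hG).mono (by omega)⟩
  have hqM : q ∈ Fl (k + 1 + 1) := by
    have := sub_mem (Fl_succ hcon) hmem
    rwa [add_sub_cancel_left] at this
  obtain ⟨s, hs, t, ht, -, -, hst⟩ := hf.hasStrip_succ hr hG (k + 1) (by omega) q hq hqM
  -- Here `u * Z₁` dominates; its cancellation would lower the degree of `u` modulo `Q f (n + 1)`.
  have key : s * X₁ + (t - u) * Z₁ ∈ Fl (k + 1) := by
    convert sub_mem (sub_mem (sub_mem hcon hst) hGX) hu using 1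
    rw [sub_mul, mul_sub, mul_one]
    abel
  refine hu' (-t) (neg_mem ht) ?_
  have := neg_mem (mem_Fl_of_strip key).2
  rwa [neg_sub, sub_eq_add_neg] at this

/-- Modulo `Q f (n + 1)`, `f (X₁ ^ (n + 1))` is `G * X₁` plus a left multiple of `1 - Z₁`. As `Q f
(n + 1)` is stable under right multiplication by `1 - Z₁`, the multiplier may be taken of least
degree in its coset. -/
theorem IsAdmissible.hasReduced {f : V →ₗ[ZMod 2] V} (hf : IsAdmissible f) (h1 : f 1 ≠ 0)
    (n : ℕ) : HasReduced f n := by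
  induction n with
  | zero =>
    have hQ : ∀ q ∈ Q f 0, q = 0 := fun q hq => by
      obtain ⟨v, hv, rfl⟩ := mem_Q.1 hq
      have : v = 0 := by simpa using hv
      simp [this]
    obtain ⟨d, hd, hd'⟩ := exists_degree h1
    refine ⟨f 1, d, ⟨hd, fun q hq => by simpa [hQ q hq] using hd', fun M _ q hq _ => ?_⟩, by simp⟩
    exact ⟨0, zero_mem _, 0, zero_mem _, zero_mem _, zero_mem _, by simp [hQ q hq]⟩
  | succ n ih =>
    obtain ⟨G, d, hr, hG⟩ := ih
    obtain ⟨w, hw⟩ := hf.map_mul_X₁ (X₁ ^ n)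
    obtain ⟨q, hq, w', hw'⟩ := hf.Q_mul_X₁ hG
    obtain ⟨u, hu, hmin⟩ := exists_minimal_representative (Q f (n + 1)) (w + w')
    refine ⟨G * X₁ + u * (1 - Z₁), ?_⟩
    have hdiff : f (X₁ ^ (n + 1)) - (G * X₁ + u * (1 - Z₁)) ∈ Q f (n + 1) := by
      convert add_mem hq (hf.Q_mul hu S_one_sub_Z₁) using 1
      have h3 : f (X₁ ^ n) * X₁ = G * X₁ + (q + w' * (1 - Z₁)) := by
        rw [← hw']; noncomm_ring
      rw [pow_succ, hw, h3, sub_mul, add_mul]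
      abel
    rcases hmin with rfl | ⟨k, hk, hk'⟩
    · exact ⟨d + 1, hf.isReduced_succ_low hr hG (zero_mem _), hdiff⟩
    · rcases Nat.lt_or_ge d k with hdk | hdk
      · exact ⟨k + 1, hf.isReduced_succ_high hr hG hdk hk hk', hdiff⟩
      · exact ⟨d + 1, hf.isReduced_succ_low hr hG (Fl_mono (by omega) hk), hdiff⟩

/-- An admissible operator that does not kill `1` is injective. -/
theorem IsAdmissible.map_ne_zero {f : V →ₗ[ZMod 2] V} (hf : IsAdmissible f) (h1 : f 1 ≠ 0)
    {g : V} (hg : g ≠ 0) : f g ≠ 0 := by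
  classical
  -- The least such exponent is `n + 1`, and `(S ^ n) g` is then the nonzero `b` multiplying `G`.
  have h : ∃ n, (S ^ n) g = 0 := by
    obtain ⟨n, hn⟩ := exists_mem_Fl g
    exact ⟨_, S_pow_eq_zero hn⟩
  rcases hk : Nat.find h with _ | n
  · have := Nat.find_spec h
    rw [hk] at this
    exact absurd (by simpa using this) hg
  · have hz := Nat.find_spec h
    rw [hk] at hz
    have hnz := Nat.find_min h (m := n) (by omega)
    obtain ⟨G, d, hr, hG⟩ := hf.hasReduced h1 n
    obtain ⟨hb, q, hq, hfg⟩ := hf.map_eq hz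
    obtain ⟨m, hm, hm'⟩ := exists_degree hnz
    intro h0
    refine hr.add_mul_notMem hm hm' (add_mem (hf.Q_mul hG hb) hq) ?_
    have : G * (S ^ n) g + ((f (X₁ ^ n) - G) * (S ^ n) g + q) = f g := by
      rw [hfg]; noncomm_ring
    rw [this, h0]
    exact zero_mem _

/-! ### The ring `R` acting on the free algebra -/

/-- The generator `a` of `R`. -/
def gA : R := RingQuot.mkAlgHom (ZMod 2) Rel (FreeAlgebra.ι (ZMod 2) Letter.a)

/-- The generator `x` of `R`. -/
def gX : R := RingQuot.mkAlgHom (ZMod 2) Rel (FreeAlgebra.ι (ZMod 2) Letter.x)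

theorem gA_mul_gA_mul_gX : gA * (gA * gX) = gA := by
  have := RingQuot.mkAlgHom_rel (ZMod 2) Rel.rel
  rw [map_mul, map_pow, pow_two, mul_assoc] at this
  exact this.symm

theorem gA_mul_one_sub : gA * (1 - gA * gX) = 0 := by
  rw [mul_sub, mul_one, gA_mul_gA_mul_gX, sub_self]

/-- The operator by which `a` acts. -/
def opA : V →ₗ[ZMod 2] V := LinearMap.mulLeft (ZMod 2) (1 - Z₁) ∘ₗ S

theorem opA_apply (v : V) : opA v = (1 - Z₁) * S v := rfl

theorem S_one_sub_Z₁_mul (v : V) : S ((1 - Z₁) * v) = S v := by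
  rw [sub_mul, one_mul, map_sub, S_Z₁_mul, sub_zero]

/-- The action of the free algebra on `a, x`. -/
def preAct : FreeAlgebra (ZMod 2) Letter →ₐ[ZMod 2] Module.End (ZMod 2) V :=
  FreeAlgebra.lift (ZMod 2) fun
    | Letter.a => opA
    | Letter.x => LinearMap.mulLeft (ZMod 2) X₁

theorem preAct_rel {u v : FreeAlgebra (ZMod 2) Letter} (h : Rel u v) : preAct u = preAct v := by
  cases h
  refine LinearMap.ext fun v => ?_
  simp [preAct, pow_two, opA_apply, S_one_sub_Z₁_mul]

/-- The action of `R` on the free algebra. -/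
def act : R →ₐ[ZMod 2] Module.End (ZMod 2) V :=
  RingQuot.liftAlgHom (ZMod 2) ⟨preAct, fun _ _ h => preAct_rel h⟩

@[simp] theorem act_gA (v : V) : act gA v = (1 - Z₁) * S v := by
  simp [act, gA, preAct, opA_apply]

@[simp] theorem act_gX (v : V) : act gX v = X₁ * v := by
  simp [act, gX, preAct]

theorem R_induction {P : R → Prop} (h1 : P 1) (hadd : ∀ r s, P r → P s → P (r + s))
    (hA : ∀ r, P r → P (gA * r)) (hX : ∀ r, P r → P (gX * r)) (r : R) : P r := by
  have h0 : P 0 := by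
    have h2 := congrArg (algebraMap (ZMod 2) R) (show (1 : ZMod 2) + 1 = 0 from rfl)
    rw [map_add, map_one, map_zero] at h2
    exact h2 ▸ hadd 1 1 h1 h1
  have key : ∀ c r, P r → P (RingQuot.mkAlgHom (ZMod 2) Rel c * r) := by
    intro c
    induction c using FreeAlgebra.induction with
    | grade0 c =>
      intro r hr
      rcases eq_zero_or_eq_one c with rfl | rfl
      · simpa using h0
      · simpa using hr
    | grade1 l => cases l with
      | a => exact hA
      | x => exact hX
    | mul u v hu hv =>
      intro r hr
      rw [map_mul, mul_assoc]
      exact hu _ (hv _ hr)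
    | add u v hu hv =>
      intro r hr
      rw [map_add, add_mul]
      exact hadd _ _ (hu _ hr) (hv _ hr)
  obtain ⟨c, rfl⟩ := RingQuot.mkAlgHom_surjective (ZMod 2) Rel r
  simpa using key c 1 h1

theorem isAdmissible_act (r : R) : IsAdmissible (act r) := by
  induction r using R_induction with
  | h1 => exact ⟨fun v b _ => by simp, fun v => ⟨0, by simp⟩⟩
  | hadd r s hr hs =>
    refine ⟨fun v b hb => ?_, fun v => ?_⟩
    · simp [hr.map_mul v b hb, hs.map_mul v b hb, add_mul]
    · obtain ⟨w, hw⟩ := hr.map_mul_X₁ v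
      obtain ⟨w', hw'⟩ := hs.map_mul_X₁ v
      refine ⟨w + w', ?_⟩
      rw [map_add, LinearMap.add_apply, LinearMap.add_apply, hw, hw', add_mul, add_mul]
      abel
  | hA r hr =>
    refine ⟨fun v b hb => ?_, fun v => ?_⟩
    · simp only [map_mul, Module.End.mul_apply, act_gA, hr.map_mul v b hb,
        S_mul_of_S_eq_zero _ hb, mul_assoc]
    · obtain ⟨w, hw⟩ := hr.map_mul_X₁ v
      -- The first term is the defect of `S` against right multiplication by `X₁`.
      refine ⟨aug (act r v) • 1 + (1 - Z₁) * S w, ?_⟩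
      simp only [map_mul, Module.End.mul_apply, act_gA, hw, map_add,
        S_mul_of_S_eq_zero _ S_one_sub_Z₁, S_mul (act r v), S_X₁]
      simp only [mul_add, add_mul, smul_mul_assoc, one_mul, mul_smul_comm, mul_one, mul_assoc]
      abel
  | hX r hr =>
    refine ⟨fun v b hb => ?_, fun v => ?_⟩
    · simp only [map_mul, Module.End.mul_apply, act_gX, hr.map_mul v b hb, mul_assoc]
    · obtain ⟨w, hw⟩ := hr.map_mul_X₁ v
      refine ⟨X₁ * w, ?_⟩
      simp only [map_mul, Module.End.mul_apply, act_gX, hw, mul_add, mul_assoc]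

/-! ### Expansions in powers of `a`, and zero divisors -/

/-- The embedding of the free algebra into `R`, with `X₁ ↦ x` and `Z₁ ↦ 1 - a x`. -/
def emb : V →ₐ[ZMod 2] R := FreeAlgebra.lift (ZMod 2) fun b => if b then gX else 1 - gA * gX

@[simp] theorem emb_X₁ : emb X₁ = gX := by simp [emb, X₁]
@[simp] theorem emb_Z₁ : emb Z₁ = 1 - gA * gX := by simp [emb, Z₁]

@[simp] theorem act_emb (u v : V) : act (emb u) v = u * v := by
  induction u using V_induction generalizing v with
  | h1 => simp
  | hX => simp
  | hZ => simp [sub_mul]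
  | hmul u w hu hw => simp [hu, hw, mul_assoc]
  | hadd u w hu hw => simp [hu, hw, add_mul]

/-- The rule that moves `a` to the right of the free subalgebra; only the constant term lets `a`
through. -/
theorem gA_mul_emb (v : V) : gA * emb v = emb ((1 - Z₁) * S v) + emb (aug v • 1) * gA := by
  induction v using V_induction with
  | h1 => simp
  | hX => simp
  | hZ => simp [gA_mul_one_sub]
  | hmul u v hu hv =>
    calc gA * emb (u * v)
        = emb ((1 - Z₁) * S u) * emb v + emb (aug u • 1) * (gA * emb v) := by
          rw [map_mul, ← mul_assoc, hu, add_mul, mul_assoc _ gA]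
      _ = _ := by
          rw [hv]
          simp only [S_mul, map_mul, map_add, map_smul, map_one, mul_add, mul_smul_comm,
            smul_mul_assoc, one_mul, mul_assoc, smul_smul, mul_comm (aug u)]
          abel
  | hadd u v hu hv =>
    rw [map_add, mul_add, hu, hv]
    simp only [map_add, mul_add, add_smul, add_mul]
    abel

/-- The finite expansions `∑ₖ emb vₖ * aᵏ`. -/
inductive HasExpansion : R → Prop
  | zero : HasExpansion 0
  | step (v : V) (r : R) : HasExpansion r → HasExpansion (emb v + r * gA)

theorem HasExpansion.add {r s : R} (hr : HasExpansion r) (hs : HasExpansion s) :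
    HasExpansion (r + s) := by
  induction hr generalizing s with
  | zero => simpa using hs
  | step v r hr ih =>
    cases hs with
    | zero => simpa using HasExpansion.step v r hr
    | step w t ht =>
      have := HasExpansion.step (v + w) _ (ih ht)
      convert this using 1
      rw [map_add, add_mul]
      abel

theorem hasExpansion_emb (v : V) : HasExpansion (emb v) := by
  simpa using HasExpansion.step v 0 HasExpansion.zero

theorem hasExpansion (r : R) : HasExpansion r := by
  induction r using R_induction with
  | h1 => simpa using hasExpansion_emb 1
  | hadd r s hr hs => exact hr.add hs
  | hA r hr =>
    induction hr with
    | zero => simpa using HasExpansion.zero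
    | step v r _ ih =>
      have := HasExpansion.step ((1 - Z₁) * S v) _ ((hasExpansion_emb (aug v • 1)).add ih)
      convert this using 1
      rw [mul_add, gA_mul_emb, add_mul, mul_assoc, add_assoc]
  | hX r hr =>
    induction hr with
    | zero => simpa using HasExpansion.zero
    | step v r _ ih =>
      have := HasExpansion.step (X₁ * v) _ ih
      convert this using 1
      rw [mul_add, map_mul, emb_X₁, mul_assoc]

/-- Every nonzero element of `R` is a right multiple `s * a ^ m` with `s` not killing `1`. -/
theorem exists_eq_mul_pow {r : R} (hr : r ≠ 0) :
    ∃ s m, r = s * gA ^ m ∧ act s 1 ≠ 0 := by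
  induction hasExpansion r with
  | zero => exact absurd rfl hr
  | step v r _ ih =>
    by_cases hv : v = 0
    · subst hv
      rw [map_zero, zero_add] at hr ⊢
      obtain ⟨s, m, rfl, hs⟩ := ih (left_ne_zero_of_mul hr)
      exact ⟨s, m + 1, by rw [pow_succ, mul_assoc], hs⟩
    -- Since `a` kills `1`, the expansion sends `1` to its constant coefficient `v`.
    · exact ⟨_, 0, by rw [pow_zero, mul_one], by simpa using hv⟩

theorem one_sub_Z₁_ne_zero : (1 - Z₁ : V) ≠ 0 := fun h => by
  simpa using congrArg aug h

theorem S_X₁_pow (m : ℕ) : (S ^ m) (X₁ ^ m) = 1 := by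
  simpa using S_pow_X₁_pow_mul m 1

theorem act_gA_pow_succ (m : ℕ) (v : V) :
    act (gA ^ (m + 1)) v = (1 - Z₁) * (S ^ (m + 1)) v := by
  induction m with
  | zero => simp
  | succ m ih =>
    rw [pow_succ', map_mul, Module.End.mul_apply, ih, act_gA, S_one_sub_Z₁_mul, pow_succ' S (m + 1),
      Module.End.mul_apply]

theorem act_gA_pow_X₁_pow_ne_zero (m : ℕ) : act (gA ^ m) (X₁ ^ m) ≠ 0 := by
  cases m with
  | zero => simp
  | succ m => rw [act_gA_pow_succ, S_X₁_pow, mul_one]; exact one_sub_Z₁_ne_zero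

theorem act_gA_pow_succ_X₁_pow (m : ℕ) : act (gA ^ (m + 1)) (X₁ ^ m) = 0 := by
  rw [act_gA_pow_succ, pow_succ', Module.End.mul_apply, S_X₁_pow, S_one, mul_zero]

theorem gA_pow_ne_zero (m : ℕ) : gA ^ m ≠ 0 := fun h =>
  act_gA_pow_X₁_pow_ne_zero m (by rw [h]; simp)

theorem act_injective {r : R} (h : act r = 0) : r = 0 := by
  by_contra hr
  obtain ⟨s, m, rfl, hs⟩ := exists_eq_mul_pow hr
  refine (isAdmissible_act s).map_ne_zero hs (act_gA_pow_X₁_pow_ne_zero m) ?_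
  rw [← Module.End.mul_apply, ← map_mul, h, LinearMap.zero_apply]

theorem eq_zero_of_mul_eq_zero {s g : R} (hs : act s 1 ≠ 0) (h : s * g = 0) : g = 0 := by
  refine act_injective (LinearMap.ext fun v => ?_)
  by_contra hv
  refine (isAdmissible_act s).map_ne_zero hs hv ?_
  rw [← Module.End.mul_apply, ← map_mul, h, map_zero, LinearMap.zero_apply]

/-- In a product equal to zero, the left factor is a left multiple of a power of `a` killing the
right factor. -/
theorem exists_pow_mul_eq_zero {f g : R} (hf : f ≠ 0) (h : f * g = 0) :
    ∃ s m, f = s * gA ^ m ∧ gA ^ m * g = 0 := by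
  obtain ⟨s, m, rfl, hs⟩ := exists_eq_mul_pow hf
  exact ⟨s, m, rfl, eq_zero_of_mul_eq_zero hs (by rwa [← mul_assoc])⟩

/-- As `g ≠ 0`, the exponent of `a` in `f` is positive, and `a` kills `1 - a x`. The annihilator
does not depend on `f`. -/
theorem mul_one_sub_eq_zero {f g : R} (hf : f ≠ 0) (hg : g ≠ 0) (h : f * g = 0) :
    f * (1 - gA * gX) = 0 := by
  obtain ⟨s, m, rfl, hm⟩ := exists_pow_mul_eq_zero hf h
  cases m with
  | zero => exact absurd (by simpa using hm) hg
  | succ m => rw [pow_succ, mul_assoc, mul_assoc, gA_mul_one_sub, mul_zero, mul_zero]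

theorem one_sub_ne_zero : (1 - gA * gX : R) ≠ 0 := fun h => by
  have hz : act (1 - gA * gX) 1 = Z₁ := by rw [← emb_Z₁]; simp
  rw [h] at hz
  have := congrArg (T false) hz
  simp at this

theorem pow_mul_eq_zero_of_le {m n : ℕ} (h : m ≤ n) {g : R} (hg : gA ^ m * g = 0) :
    gA ^ n * g = 0 := by
  obtain ⟨k, rfl⟩ := Nat.exists_eq_add_of_le h
  rw [add_comm, pow_add, mul_assoc, hg, mul_zero]

/-! ### Linear polynomials and the three assertions -/

theorem ne_zero_of_coeff_eq {S : Type*} [Ring S] {f : S[X]} (hf : f ≠ 0) (hd : f.natDegree ≤ 1)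
    (h : f.coeff 0 = 0) : f.coeff 1 ≠ 0 := fun h1 => hf (by
  rw [eq_X_add_C_of_natDegree_le_one hd, h, h1]; simp)

theorem coeff_mul_linear {S : Type*} [Ring S] {f g : S[X]} (hf : f.natDegree ≤ 1)
    (hg : g.natDegree ≤ 1) (h : f * g = 0) :
    f.coeff 0 * g.coeff 0 = 0 ∧ f.coeff 0 * g.coeff 1 + f.coeff 1 * g.coeff 0 = 0 ∧
      f.coeff 1 * g.coeff 1 = 0 := by
  refine ⟨by rw [← mul_coeff_zero, h, coeff_zero], ?_, ?_⟩
  · rw [← mul_coeff_one, h, coeff_zero]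
  · rw [← coeff_mul_add_eq_of_natDegree_le hf hg, h, coeff_zero]

theorem mul_C_eq_zero {S : Type*} [Ring S] {f : S[X]} (hf : f.natDegree ≤ 1) {s : S}
    (h0 : f.coeff 0 * s = 0) (h1 : f.coeff 1 * s = 0) : f * C s = 0 := by
  ext n
  rw [coeff_mul_C, coeff_zero]
  rcases n with _ | _ | n
  · exact h0
  · exact h1
  · rw [coeff_eq_zero_of_natDegree_lt (by omega), zero_mul]

theorem C_mul_eq_zero {S : Type*} [Ring S] {g : S[X]} (hg : g.natDegree ≤ 1) {s : S}
    (h0 : s * g.coeff 0 = 0) (h1 : s * g.coeff 1 = 0) : C s * g = 0 := by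
  ext n
  rw [coeff_C_mul, coeff_zero]
  rcases n with _ | _ | n
  · exact h0
  · exact h1
  · rw [coeff_eq_zero_of_natDegree_lt (by omega), mul_zero]

theorem isRightLinearlyMcCoy_R : IsRightLinearlyMcCoy R := by
  intro f g hf hg hdf hdg h
  obtain ⟨h0, h01, h1⟩ := coeff_mul_linear hdf hdg h
  by_cases hg0 : g.coeff 0 = 0
  · refine ⟨g.coeff 1, ne_zero_of_coeff_eq hg hdg hg0, mul_C_eq_zero hdf ?_ h1⟩
    simpa [hg0] using h01
  by_cases hg1 : g.coeff 1 = 0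
  · refine ⟨g.coeff 0, hg0, mul_C_eq_zero hdf h0 ?_⟩
    simpa [hg1] using h01
  -- With both coefficients of `g` nonzero, each nonzero coefficient of `f` is a left zero divisor,
  -- so `1 - a x` works for both.
  refine ⟨_, one_sub_ne_zero, mul_C_eq_zero hdf ?_ ?_⟩
  · by_cases hf0 : f.coeff 0 = 0
    · rw [hf0, zero_mul]
    · exact mul_one_sub_eq_zero hf0 hg0 h0
  · by_cases hf1 : f.coeff 1 = 0
    · rw [hf1, zero_mul]
    · exact mul_one_sub_eq_zero hf1 hg1 h1

theorem isLeftLinearlyMcCoy_R : IsLeftLinearlyMcCoy R := by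
  intro f g hf hg hdf hdg h
  obtain ⟨h0, h01, h1⟩ := coeff_mul_linear hdf hdg h
  by_cases hf0 : f.coeff 0 = 0
  · refine ⟨f.coeff 1, ne_zero_of_coeff_eq hf hdf hf0, C_mul_eq_zero hdg ?_ h1⟩
    simpa [hf0] using h01
  by_cases hf1 : f.coeff 1 = 0
  · refine ⟨f.coeff 0, hf0, C_mul_eq_zero hdg h0 ?_⟩
    simpa [hf1] using h01
  obtain ⟨-, m, -, hm⟩ := exists_pow_mul_eq_zero hf0 h0
  obtain ⟨-, n, -, hn⟩ := exists_pow_mul_eq_zero hf1 h1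
  exact ⟨gA ^ max m n, gA_pow_ne_zero _, C_mul_eq_zero hdg
    (pow_mul_eq_zero_of_le (le_max_left _ _) hm) (pow_mul_eq_zero_of_le (le_max_right _ _) hn)⟩

theorem not_isRightDischinger_R : ¬ IsRightDischinger R := by
  intro h
  have hA : IsRightStronglyPiRegular gA :=
    ⟨1, le_rfl, gX, by rw [pow_one, pow_two, mul_assoc, gA_mul_gA_mul_gX]⟩
  obtain ⟨n, -, t, ht⟩ := (h gA hA).2
  -- Test on `X₁ ^ n`, which `a ^ (n + 1)` kills.
  refine act_gA_pow_X₁_pow_ne_zero n ?_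
  rw [ht, map_mul, Module.End.mul_apply, act_gA_pow_succ_X₁_pow, map_zero]

end LinMcCoy

theorem mainTheorem7 :
    (LinMcCoy.IsLeftLinearlyMcCoy LinMcCoy.R ∧ LinMcCoy.IsRightLinearlyMcCoy LinMcCoy.R) ∧
      ¬ LinMcCoy.IsRightDischinger LinMcCoy.R :=
  ⟨⟨LinMcCoy.isLeftLinearlyMcCoy_R, LinMcCoy.isRightLinearlyMcCoy_R⟩,
    LinMcCoy.not_isRightDischinger_R⟩
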